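/- Let $\mathbb F_q$ be a finite field with $q$ elements and characteristic different from $2$. Let $\mathcal O=\mathbb F_q[[\pi]]$ and let $[\,\cdot\,]:\mathbb F_q((\pi))\to\mathbb F_q[\pi^{-1}]$ be the integral part, $\big[\sum_{n}a_n\pi^{-n}\big]=\sum_{n\ge 0}a_n\pi^{-n}$. For $x,y,z\in\mathbb F_q[\pi^{-1}]$ put $$h_1(x,y,z)=\begin{pmatrix}1&0&x&z\\0&1&y&x\\0&0&1&0\\0&0&0&1\end{pmatrix},\qquad h_2(x,y,z)=\begin{pmatrix}1&x&y/2&z\\0&1&0&y/2\\0&0&1&-x\\0&0&0&1\end{pmatrix},$$ and let $H_1=\{h_1(x,y,z)\}$ and $H_2=\{h_2(x,y,z)\}$ (with $x,y,z$ ranging over $\mathbb F_q[\pi^{-1}]$), which are subgroups of $SL_4(\mathbb F_q[\pi^{-1}])$. For a discrete group $G$ and $\varphi\in\mathbb C G$, let $\|\varphi\|_{C^*_r(G)}$ be the operator norm of $\varphi$ acting on $\ell^2(G)$ by the left regular representation, and let $e_g\in\mathbb C G$ be the point mass at $g$. For integers $i,j\ge 0$ (with $j\le i$ in the second line), with $m=\lfloor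 (i+j)/2\rfloor$, and with $\mathbb E$ denoting the mean over a finite set, define $$h_{1,i,j}=\mathop{\mathbb E}_{a\in\mathcal O/\pi^{i+1}\mathcal O}e_{h_1([\pi^{-i}a],\;\pi^{-i},\;[\pi^{-i}a^2]+\pi^{-j})}\in\mathbb C H_1,$$ $$h_{2,i,j}=\mathop{\mathbb E}_{a,b,c\in\mathcal O/\pi^{i+1}\mathcal O}e_{h_2([\pi^{-m}(1+\pi a)],\;[\pi^{-m}b],\;[\pi^{-i}(1+\pi c)])}\in\mathbb C H_2 .$$ (The integral parts do not depend on the representatives of $a,b,c$ in $\mathcal O$.) For all integers $i\ge j\ge 0$, the element $\Delta_{1,i,j}=h_{1,i,j}-h_{1,i,j+1}$ satisfies $$\|\Delta_{1,i,j}\|_{C^*_r(H_1)}\le 2q^{-(i-j)/2}.$$ For all integers $i\ge j\ge 1$, the element $\Delta_{2,i,j}=h_{2,i,j}-h_{2,i+1,j-1}$ satisfies $$\|\Delta_{2,i,j}\|_{C^*_r(H_2)}\le 2q^2\cdot q^{-j}.$$ -/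

import Mathlib

open scoped Polynomial PowerSeries LaurentSeries

noncomputable section

namespace ExplicitDiff

/-! ### The reduced group C*-norm -/

section ReducedNorm

/-- The Hilbert space `ℓ²(G)`. -/
abbrev EllTwo (G : Type*) := lp (fun _ : G => ℂ) 2

variable {G : Type*} [Group G]

/-- Left translation `(λ_g f)(h) = f (g⁻¹ h)` on `ℓ²(G)`. -/
def translate (g : G) (f : EllTwo G) : EllTwo G :=
  ⟨fun h => f (g⁻¹ * h), by
    refine memℓp_gen ?_
    have hf := (lp.memℓp f).summable (by norm_num)
    exact (Equiv.mulLeft g⁻¹).summable_iff.mpr hf⟩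

@[simp] theorem translate_apply (g : G) (f : EllTwo G) (h : G) :
    translate g f h = f (g⁻¹ * h) := rfl

theorem norm_translate (g : G) (f : EllTwo G) : ‖translate g f‖ = ‖f‖ := by
  rw [lp.norm_eq_tsum_rpow (by norm_num), lp.norm_eq_tsum_rpow (by norm_num)]
  congr 1
  exact (Equiv.mulLeft g⁻¹).tsum_eq (fun h => ‖f h‖ ^ (2 : ENNReal).toReal)

variable (G) in
/-- The left regular representation of `G` on `ℓ²(G)`. -/
def leftRegular : G →* (EllTwo G →L[ℂ] EllTwo G) where
  toFun g := LinearMap.mkContinuous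
    { toFun := translate g
      map_add' := fun f₁ f₂ => by ext h; rfl
      map_smul' := fun c f => by ext h; rfl } 1
    (fun f => by simpa using (norm_translate g f).le)
  map_one' := by ext f h; simp
  map_mul' a b := by ext f h; simp [mul_assoc]

@[simp] theorem leftRegular_apply (g : G) (f : EllTwo G) (h : G) :
    leftRegular G g f h = f (g⁻¹ * h) := rfl

/-- The norm of `C*_r(G)` on the group algebra `ℂ[G]`: the operator norm on `ℓ²(G)` of the image
of `φ` under the linear extension of the left regular representation. -/
def reducedNorm (φ : MonoidAlgebra ℂ G) : ℝ :=
  ‖MonoidAlgebra.lift ℂ (EllTwo G →L[ℂ] EllTwo G) G (leftRegular G) φ‖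

end ReducedNorm

/-- The mean `(1 / |ι|) ∑ x, f x` of a vector-valued function on a finite set. -/
def average {ι V : Type*} [Fintype ι] [AddCommGroup V] [Module ℂ V] (f : ι → V) : V :=
  ((Fintype.card ι : ℂ)⁻¹) • ∑ x, f x

section

variable (k : Type*) [Field k]

/-! ### Local field, integral part

`k⟦X⟧` is the ring of integers `𝒪 = k[[π]]` (there `X` is `π`), `k⸨X⸩` is the local field `k((π))`,
and `k[X]` is `k[π⁻¹]`, whose variable `X` is `π⁻¹`. -/

/-- The finite ring `𝒪 / πⁿ 𝒪`. -/
abbrev ResidueRing (n : ℕ) := k⟦X⟧ ⧸ (Ideal.span {(PowerSeries.X : k⟦X⟧) ^ n} : Ideal k⟦X⟧)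

theorem finite_residueRing [Finite k] (n : ℕ) : Finite (ResidueRing k n) := by
  let F : (Fin n → k) → ResidueRing k n := fun v =>
    Ideal.Quotient.mk _ (PowerSeries.mk fun l => if h : l < n then v ⟨l, h⟩ else 0)
  refine Finite.of_surjective F fun b => ?_
  obtain ⟨f, rfl⟩ := Ideal.Quotient.mk_surjective b
  refine ⟨fun l => PowerSeries.coeff (l : ℕ) f, ?_⟩
  refine Ideal.Quotient.eq.mpr (Ideal.mem_span_singleton.mpr (PowerSeries.X_pow_dvd_iff.mpr ?_))
  intro l hl
  simp [hl]

instance [Finite k] (n : ℕ) : Fintype (ResidueRing k n) :=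
  @Fintype.ofFinite _ (finite_residueRing k n)

variable {k}

/-- A representative in `𝒪` of a class in `𝒪 / πⁿ 𝒪`. -/
def rep {n : ℕ} (a : ResidueRing k n) : k⟦X⟧ := Quotient.out a

theorem mk_rep {n : ℕ} (a : ResidueRing k n) : Ideal.Quotient.mk _ (rep a) = a :=
  Quotient.out_eq a

/-- The integral part `k((π)) → k[π⁻¹]`, which keeps the terms `f₋ₙ π⁻ⁿ` with `n ≥ 0`.
(All nonzero terms have `n ≤ -ord f`, hence the range of the sum.) -/
def intPart (f : k⸨X⸩) : k[X] :=
  ∑ n ∈ Finset.range ((-f.order).toNat + 1), Polynomial.monomial n (f.coeff (-(n : ℤ)))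

theorem coeff_intPart (f : k⸨X⸩) (n : ℕ) : (intPart f).coeff n = f.coeff (-(n : ℤ)) := by
  classical
  simp only [intPart, Polynomial.finsetSum_coeff, Polynomial.coeff_monomial]
  rw [Finset.sum_ite_eq' (Finset.range ((-f.order).toNat + 1)) n]
  split_ifs with h
  · rfl
  · symm
    apply HahnSeries.coeff_eq_zero_of_lt_order
    simp only [Finset.mem_range] at h
    omega

/-- `[π⁻ˡ a]` for `a ∈ 𝒪`. -/
def scaledPart (l : ℕ) (a : k⟦X⟧) : k[X] :=
  intPart (HahnSeries.single (-(l : ℤ)) (1 : k) * (a : k⸨X⸩))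

theorem coeff_scaledPart (l : ℕ) (a : k⟦X⟧) (n : ℕ) :
    (scaledPart l a).coeff n = if n ≤ l then PowerSeries.coeff (l - n) a else 0 := by
  rw [scaledPart, coeff_intPart, HahnSeries.coeff_single_mul, one_mul, PowerSeries.coeff_coe]
  split_ifs with h₁ h₂ h₂
  · omega
  · rfl
  · have e : (-(n : ℤ) - -(l : ℤ)).natAbs = l - n := by omega
    rw [e]
  · omega

/-- `[π⁻ˡ a]` depends only on the class of `a` modulo `πⁿ` as soon as `l < n`. -/
theorem scaledPart_congr {l n : ℕ} (h : l < n) {a b : k⟦X⟧}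
    (hab : (Ideal.Quotient.mk _ a : ResidueRing k n) = Ideal.Quotient.mk _ b) :
    scaledPart l a = scaledPart l b := by
  have hd := PowerSeries.X_pow_dvd_iff.mp
    (Ideal.mem_span_singleton.mp (Ideal.Quotient.eq.mp hab))
  ext d
  rw [coeff_scaledPart, coeff_scaledPart]
  split_ifs with h'
  · have := hd (l - d) (by omega)
    rwa [map_sub, sub_eq_zero] at this
  · rfl

/-! ### The two subgroups -/

/-- The matrix `h₁(x, y, z)`. -/
def mat₁ (x y z : k[X]) : Matrix (Fin 4) (Fin 4) k[X] :=
  !![1, 0, x, z;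
     0, 1, y, x;
     0, 0, 1, 0;
     0, 0, 0, 1]

/-- The matrix `h₂(x, y, z)`. -/
def mat₂ (x y z : k[X]) : Matrix (Fin 4) (Fin 4) k[X] :=
  !![1, x, Polynomial.C (2⁻¹ : k) * y, z;
     0, 1, 0, Polynomial.C (2⁻¹ : k) * y;
     0, 0, 1, -x;
     0, 0, 0, 1]

theorem det_mat₁ (x y z : k[X]) : (mat₁ x y z).det = 1 := by
  simp [mat₁, Matrix.det_succ_row_zero, Fin.sum_univ_succ, Fin.succAbove]

theorem det_mat₂ (x y z : k[X]) : (mat₂ x y z).det = 1 := by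
  simp [mat₂, Matrix.det_succ_row_zero, Fin.sum_univ_succ, Fin.succAbove]

theorem mat₁_zero : mat₁ (0 : k[X]) 0 0 = 1 := by
  ext i j
  fin_cases i <;> fin_cases j <;> simp [mat₁]

theorem mat₂_zero : mat₂ (0 : k[X]) 0 0 = 1 := by
  ext i j
  fin_cases i <;> fin_cases j <;> simp [mat₂]

theorem mat₁_mul (x y z x' y' z' : k[X]) :
    mat₁ x y z * mat₁ x' y' z' = mat₁ (x + x') (y + y') (z + z') := by
  refine Matrix.ext fun i j => ?_
  fin_cases i <;> fin_cases j <;> simp [mat₁, Matrix.mul_apply, Fin.sum_univ_succ] <;> ring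

theorem mat₂_mul (x y z x' y' z' : k[X]) :
    mat₂ x y z * mat₂ x' y' z' = mat₂ (x + x') (y + y')
      (z + z' + Polynomial.C (2⁻¹ : k) * (x * y' - y * x')) := by
  refine Matrix.ext fun i j => ?_
  fin_cases i <;> fin_cases j <;> simp [mat₂, Matrix.mul_apply, Fin.sum_univ_succ] <;> ring

/-- `h₁(x, y, z)` as an element of `SL₄(k[π⁻¹])`. -/
def sl₁ (x y z : k[X]) : Matrix.SpecialLinearGroup (Fin 4) k[X] := ⟨mat₁ x y z, det_mat₁ x y z⟩

/-- `h₂(x, y, z)` as an element of `SL₄(k[π⁻¹])`. -/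
def sl₂ (x y z : k[X]) : Matrix.SpecialLinearGroup (Fin 4) k[X] := ⟨mat₂ x y z, det_mat₂ x y z⟩

theorem sl₁_zero : sl₁ (0 : k[X]) 0 0 = 1 := Subtype.ext mat₁_zero

theorem sl₂_zero : sl₂ (0 : k[X]) 0 0 = 1 := Subtype.ext mat₂_zero

theorem sl₁_mul (x y z x' y' z' : k[X]) :
    sl₁ x y z * sl₁ x' y' z' = sl₁ (x + x') (y + y') (z + z') :=
  Subtype.ext (mat₁_mul x y z x' y' z')

theorem sl₂_mul (x y z x' y' z' : k[X]) :
    sl₂ x y z * sl₂ x' y' z' = sl₂ (x + x') (y + y')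
      (z + z' + Polynomial.C (2⁻¹ : k) * (x * y' - y * x')) :=
  Subtype.ext (mat₂_mul x y z x' y' z')

variable (k)

/-- The abelian subgroup `H₁ = {h₁(x, y, z)}`. -/
def H₁ : Subgroup (Matrix.SpecialLinearGroup (Fin 4) k[X]) where
  carrier := {g | ∃ x y z : k[X], g = sl₁ x y z}
  one_mem' := ⟨0, 0, 0, sl₁_zero.symm⟩
  mul_mem' := by
    rintro _ _ ⟨x, y, z, rfl⟩ ⟨x', y', z', rfl⟩
    exact ⟨_, _, _, sl₁_mul _ _ _ _ _ _⟩
  inv_mem' := by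
    rintro _ ⟨x, y, z, rfl⟩
    refine ⟨-x, -y, -z, inv_eq_of_mul_eq_one_right ?_⟩
    rw [sl₁_mul, ← sl₁_zero]
    congr 1 <;> ring

/-- The Heisenberg-type subgroup `H₂ = {h₂(x, y, z)}`. -/
def H₂ : Subgroup (Matrix.SpecialLinearGroup (Fin 4) k[X]) where
  carrier := {g | ∃ x y z : k[X], g = sl₂ x y z}
  one_mem' := ⟨0, 0, 0, sl₂_zero.symm⟩
  mul_mem' := by
    rintro _ _ ⟨x, y, z, rfl⟩ ⟨x', y', z', rfl⟩
    exact ⟨_, _, _, sl₂_mul _ _ _ _ _ _⟩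
  inv_mem' := by
    rintro _ ⟨x, y, z, rfl⟩
    refine ⟨-x, -y, -z, inv_eq_of_mul_eq_one_right ?_⟩
    rw [sl₂_mul, ← sl₂_zero]
    congr 1 <;> ring

variable {k}

/-- `h₁(x, y, z)` as an element of `H₁`. -/
def h₁ (x y z : k[X]) : H₁ k := ⟨sl₁ x y z, x, y, z, rfl⟩

/-- `h₂(x, y, z)` as an element of `H₂`. -/
def h₂ (x y z : k[X]) : H₂ k := ⟨sl₂ x y z, x, y, z, rfl⟩

/-! ### The explicit elements of the group algebras -/

variable (k) [Finite k]

/-- The mean over `a ∈ 𝒪 / πⁱ⁺¹ 𝒪` of the point masses at `h₁([π⁻ⁱ a], π⁻ⁱ, [π⁻ⁱ a²] + π⁻ʲ)`. -/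
def mean₁ (i j : ℕ) : MonoidAlgebra ℂ (H₁ k) :=
  average fun a : ResidueRing k (i + 1) =>
    MonoidAlgebra.single
      (h₁ (scaledPart i (rep a)) (Polynomial.X ^ i)
        (scaledPart i (rep a ^ 2) + Polynomial.X ^ j)) 1

/-- The mean over `a, b, c ∈ 𝒪 / πⁱ⁺¹ 𝒪` of the point masses at
`h₂([π⁻ᵐ (1 + π a)], [π⁻ᵐ b], [π⁻ⁱ (1 + π c)])`, where `m = ⌊(i + j) / 2⌋` (used for `j ≤ i`). -/
def mean₂ (i j : ℕ) : MonoidAlgebra ℂ (H₂ k) :=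
  average fun t : ResidueRing k (i + 1) × ResidueRing k (i + 1) × ResidueRing k (i + 1) =>
    MonoidAlgebra.single
      (h₂ (scaledPart ((i + j) / 2) (1 + PowerSeries.X * rep t.1))
        (scaledPart ((i + j) / 2) (rep t.2.1))
        (scaledPart i (1 + PowerSeries.X * rep t.2.2))) 1

/-- `Δ_{1,i,j}`. -/
def Δ₁ (i j : ℕ) : MonoidAlgebra ℂ (H₁ k) := mean₁ k i j - mean₁ k i (j + 1)

/-- `Δ_{2,i,j}`, for `j ≥ 1`. -/
def Δ₂ (i j : ℕ) : MonoidAlgebra ℂ (H₂ k) := mean₂ k i j - mean₂ k (i + 1) (j - 1)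

end

end ExplicitDiff

end

/-!
The reduced norm is the operator norm in the regular representation, which is unitary, so the
bounds are proved for any homomorphism `ρ` from the group to the unitary group of a C*-algebra.
No Fourier analysis is needed: each cancellation comes from a mean over a finite subgroup, which
absorbs the operators of that subgroup.

*Abelian group.* `Δ₁ = T D`, where `T` is the mean over `a` of the operators of
`h₁([π⁻ⁱ a], π⁻ⁱ, [π⁻ⁱ a²])` and `D` is the difference of those of the central elements `π⁻ʲ` and
`π⁻⁽ʲ⁺¹⁾`. Expanding `(T D)* (T D)` and substituting `b = a + d`, as for a quadratic Gauss sum,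
leaves a mean over `d` of terms containing the mean over `a` of the operators of `[2π⁻ⁱ a d]`. The
elements `[2π⁻ⁱ a d]` form a subgroup that contains `π⁻⁽ʲ⁺¹⁾ - π⁻ʲ` unless `π^(i-j)` divides `d`
(`average_op₁_mul_sub_eq_zero`), so only a proportion `q^(-(i-j))` of the `d` contributes, and
`‖Δ₁‖² ≤ 4 q^(-(i-j))`.

*Heisenberg group.* `Δ₂` is the mean over monic `x` of degree `m` of the operators
`A_x = h₂(x, 0, 0) Q_x D`. Here `Q_x` is the projection given by the mean of the `h₂(0, y, -xy/2)`,
`deg y ≤ m`, and `D` is the difference of the means over the central elements that are monic of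
degrees `i` and `i + 1`. The product `Q_x Q_x'` contains the mean over the central elements
`(x - x') y / 2` (`fibreProj_mul_fibreProj`), and that mean kills `D` once
`deg (x - x') ≥ i + 1 - m` (`average_mul_monicMean_sub_eq_zero`). Since conjugation by
`h₂(e, 0, 0)` permutes the `Q_x`, both `A_x* A_x'` and `A_x A_x'*` vanish for such pairs. Hence the
`A_x` split into mutually orthogonal blocks of at most `q^(i+1-m)` of the `q^m` members, and the norm of
the mean is at most `2 q^(i+1-2m)` (`norm_average_le_of_orthogonal_classes`). The bound follows
from `i + j ≤ 2m + 1`.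
-/

noncomputable section

namespace ExplicitDiff

/-! ### Averages -/

section Average

variable {ι κ V V' : Type*} [Fintype ι] [Fintype κ] [AddCommGroup V] [Module ℂ V]
  [AddCommGroup V'] [Module ℂ V']

theorem map_average (L : V →ₗ[ℂ] V') (f : ι → V) : L (average f) = average fun x => L (f x) := by
  simp [average]

theorem average_const [Nonempty ι] (v : V) : average (fun _ : ι => v) = v := by
  have h : (Fintype.card ι : ℂ) ≠ 0 := by exact_mod_cast Fintype.card_ne_zero
  simp only [average, Finset.sum_const, Finset.card_univ]
  rw [← Nat.cast_smul_eq_nsmul ℂ, smul_smul, inv_mul_cancel₀ h, one_smul]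

theorem average_equiv (e : ι ≃ κ) (f : κ → V) : (average fun x => f (e x)) = average f := by
  rw [average, average, Fintype.card_congr e, e.sum_comp]

theorem average_prod (f : ι × κ → V) :
    average f = average fun x => average fun y => f (x, y) := by
  simp only [average, Fintype.card_prod, Fintype.sum_prod_type, ← Finset.smul_sum, smul_smul,
    Nat.cast_mul, mul_inv]

theorem average_comm (f : ι → κ → V) :
    (average fun x => average fun y => f x y) = average fun y => average fun x => f x y := by
  simp only [average, ← Finset.smul_sum, smul_smul]
  rw [Finset.sum_comm, mul_comm]

theorem average_mul {W : Type*} [Ring W] [Algebra ℂ W] (f : ι → W) (w : W) :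
    average f * w = average fun x => f x * w := by
  simp [average, Finset.sum_mul]

theorem mul_average {W : Type*} [Ring W] [Algebra ℂ W] (f : ι → W) (w : W) :
    w * average f = average fun x => w * f x := by
  simp [average, Finset.mul_sum]

/-- All fibres of a surjective homomorphism of finite groups have the same size, so it carries the
uniform mean to the uniform mean. -/
theorem average_comp_surjective {A B : Type*} [AddGroup A] [AddGroup B] [Fintype A] [Fintype B]
    (φ : A →+ B) (hφ : Function.Surjective φ) (f : B → V) :
    (average fun a => f (φ a)) = average f := by
  have key : (average fun p : A × B => f (φ p.1 + p.2)) = average f := by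
    rw [average_prod]
    simp only [show ∀ a, (average fun b => f (φ a + b)) = average f from
      fun a => average_equiv (Equiv.addLeft (φ a)) f]
    exact average_const _
  rw [← key, average_prod, average_comm]
  symm
  rw [← average_const (ι := B) (average fun a => f (φ a))]
  congr 1
  funext b
  obtain ⟨a, rfl⟩ := hφ b
  simpa using average_equiv (Equiv.addRight a) fun a => f (φ a)

theorem average_comp_add {A : Type*} [AddGroup A] [Fintype A] (f : A → V) (a : A) :
    (average fun x => f (x + a)) = average f :=
  average_equiv (Equiv.addRight a) f

theorem norm_average_le {V : Type*} [NormedAddCommGroup V] [NormedSpace ℂ V] (f : ι → V) {C : ℝ}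
    (hC : 0 ≤ C) (hf : ∀ x, ‖f x‖ ≤ C) : ‖average f‖ ≤ C := by
  rw [average, norm_smul, norm_inv, Complex.norm_natCast]
  have h : ‖∑ x, f x‖ ≤ Fintype.card ι * C := by
    simpa using norm_sum_le_of_le Finset.univ fun x _ => hf x
  rcases Nat.eq_zero_or_pos (Fintype.card ι) with h0 | h0
  · simpa [h0] using hC
  · rw [inv_mul_le_iff₀ (by exact_mod_cast h0)]
    exact h

/-- A mean over terms of norm at most `C`, all but `n` of which vanish. -/
theorem norm_average_le_of_card_le {V : Type*} [NormedAddCommGroup V] [NormedSpace ℂ V]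
    (f : ι → V) {C : ℝ} (hC : 0 ≤ C) (hf : ∀ x, ‖f x‖ ≤ C) (p : ι → Prop)
    (hp : ∀ x, ¬p x → f x = 0)
    {n : ℕ} (hn : Nat.card {x // p x} ≤ n) :
    ‖average f‖ ≤ (Fintype.card ι : ℝ)⁻¹ * (n * C) := by
  classical
  rw [average, norm_smul, norm_inv, Complex.norm_natCast]
  gcongr
  have h : ∑ x, f x = ∑ x with p x, f x := by
    rw [Finset.sum_filter]
    refine Finset.sum_congr rfl fun x _ => ?_
    split_ifs with h
    · rfl
    · exact hp x h
  rw [h]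
  refine (norm_sum_le_of_le _ fun x _ => hf x).trans ?_
  rw [Finset.sum_const, nsmul_eq_mul]
  rw [Nat.card_eq_fintype_card, Fintype.card_subtype] at hn
  gcongr

end Average

/-! ### Orthogonal families of operators -/

section CStar

variable {W : Type*} [CStarAlgebra W]

theorem norm_unitary_le (u : unitary W) : ‖(u : W)‖ ≤ 1 := by
  rcases subsingleton_or_nontrivial W with h | h
  · rw [Subsingleton.elim (u : W) 0, norm_zero]
    exact zero_le_one
  · exact (CStarRing.norm_coe_unitary u).le

theorem norm_unitary_sub_le (u v : unitary W) : ‖(u : W) - v‖ ≤ 2 := by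
  linarith [norm_sub_le (u : W) v, norm_unitary_le u, norm_unitary_le v]

theorem star_average {ι : Type*} [Fintype ι] (f : ι → W) :
    star (average f) = average fun x => star (f x) := by
  simp [average]

/-- Operators with pairwise orthogonal ranges and pairwise orthogonal initial spaces: the norm
of the sum is at most the largest norm. -/
theorem norm_sum_le_of_orthogonal {κ : Type*} (s : Finset κ) (B : κ → W) {C : ℝ} (hC : 0 ≤ C)
    (hB : ∀ c, ‖B c‖ ≤ C) (h₁ : ∀ c d, c ≠ d → star (B c) * B d = 0)
    (h₂ : ∀ c d, c ≠ d → B c * star (B d) = 0) : ‖∑ c ∈ s, B c‖ ≤ C := by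
  classical
  have e : star (∑ c ∈ s, B c) * ∑ c ∈ s, B c = ∑ c ∈ s, star (B c) * B c := by
    rw [star_sum, Finset.sum_mul]
    refine Finset.sum_congr rfl fun c hc => ?_
    rw [Finset.mul_sum]
    exact Finset.sum_eq_single_of_mem c hc fun d _ hd => h₁ c d hd.symm
  have hs : ‖∑ c ∈ s, star (B c) * B c‖₊ = s.sup fun c => ‖star (B c) * B c‖₊ := by
    refine IsSelfAdjoint.nnnorm_sum_eq_sup s (fun c _ => .star_mul_self (B c)) ?_
    intro c d hcd
    change star (B c) * B c * (star (B d) * B d) = 0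
    rw [mul_assoc, ← mul_assoc (B c), h₂ c d hcd, zero_mul, mul_zero]
  lift C to NNReal using hC
  have hle : ‖star (∑ c ∈ s, B c) * ∑ c ∈ s, B c‖₊ ≤ C * C := by
    rw [e, hs]
    refine Finset.sup_le fun c _ => ?_
    rw [CStarRing.nnnorm_star_mul_self]
    exact mul_le_mul' (hB c) (hB c)
  rw [CStarRing.nnnorm_star_mul_self] at hle
  exact_mod_cast (mul_self_le_mul_self_iff zero_le zero_le).mpr hle

/-- A block version of orthogonality: operators in different classes are orthogonal on both
sides, and each class has at most `n` members. -/
theorem norm_average_le_of_orthogonal_classes {ι κ : Type*} [Fintype ι] (A : ι → W) (cls : ι → κ)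
    {C : ℝ} (hC : 0 ≤ C) (hA : ∀ x, ‖A x‖ ≤ C)
    (h₁ : ∀ x y, cls x ≠ cls y → star (A x) * A y = 0)
    (h₂ : ∀ x y, cls x ≠ cls y → A x * star (A y) = 0)
    {n : ℕ} (hn : ∀ c, Nat.card {x // cls x = c} ≤ n) :
    ‖average A‖ ≤ (Fintype.card ι : ℝ)⁻¹ * (n * C) := by
  classical
  rw [average, norm_smul, norm_inv, Complex.norm_natCast]
  gcongr
  rw [← Finset.sum_fiberwise_of_maps_to (t := Finset.univ.image cls) (g := cls)
    fun x hx => Finset.mem_image_of_mem cls hx]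
  refine norm_sum_le_of_orthogonal _ _ (by positivity) (fun c => ?_) (fun c d hcd => ?_)
    (fun c d hcd => ?_)
  · refine (norm_sum_le_of_le _ fun x _ => hA x).trans ?_
    rw [Finset.sum_const, nsmul_eq_mul]
    have := hn c
    rw [Nat.card_eq_fintype_card, Fintype.card_subtype] at this
    gcongr
  · rw [star_sum, Finset.sum_mul_sum]
    refine Finset.sum_eq_zero fun x hx => Finset.sum_eq_zero fun y hy => h₁ x y ?_
    simp only [Finset.mem_filter] at hx hy
    rwa [hx.2, hy.2]
  · rw [star_sum, Finset.sum_mul_sum]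
    refine Finset.sum_eq_zero fun x hx => Finset.sum_eq_zero fun y hy => h₂ x y ?_
    simp only [Finset.mem_filter] at hx hy
    rwa [hx.2, hy.2]

end CStar

/-! ### The regular representation is unitary -/

section Regular

variable {G : Type*} [Group G]

theorem star_leftRegular (g : G) : star (leftRegular G g) = leftRegular G g⁻¹ := by
  rw [ContinuousLinearMap.star_eq_adjoint]
  symm
  rw [ContinuousLinearMap.eq_adjoint_iff]
  intro f f'
  rw [lp.inner_eq_tsum, lp.inner_eq_tsum]
  rw [← (Equiv.mulLeft g⁻¹).tsum_eq]
  simp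

variable (G) in
/-- The left regular representation as a homomorphism to the unitary group. -/
def unitaryRegular : G →* unitary (EllTwo G →L[ℂ] EllTwo G) where
  toFun g := ⟨leftRegular G g, by
    rw [Unitary.mem_iff, star_leftRegular, ← map_mul, ← map_mul, inv_mul_cancel, mul_inv_cancel,
      map_one]
    exact ⟨rfl, rfl⟩⟩
  map_one' := Subtype.ext (map_one _)
  map_mul' a b := Subtype.ext (map_mul _ a b)

theorem reducedNorm_eq (φ : MonoidAlgebra ℂ G) :
    reducedNorm φ = ‖MonoidAlgebra.lift ℂ (EllTwo G →L[ℂ] EllTwo G) G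
      ((unitary (EllTwo G →L[ℂ] EllTwo G)).subtype.comp (unitaryRegular G)) φ‖ := rfl

theorem lift_average_single {W : Type*} [CStarAlgebra W] (ρ : G →* unitary W) {ι : Type*}
    [Fintype ι] (g : ι → G) :
    MonoidAlgebra.lift ℂ W G ((unitary W).subtype.comp ρ)
      (average fun x => MonoidAlgebra.single (g x) 1) = average fun x => (ρ (g x) : W) := by
  have := map_average (MonoidAlgebra.lift ℂ W G ((unitary W).subtype.comp ρ)).toLinearMap
    (fun x => MonoidAlgebra.single (g x) (1 : ℂ))
  simpa using this

end Regular

/-! ### Truncated power series and polynomials of bounded degree -/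

section Truncation

variable {k : Type*} [Field k]

instance finite_degreeLT [Finite k] (n : ℕ) : Finite (Polynomial.degreeLT k n) :=
  Finite.of_equiv _ (Polynomial.degreeLTEquiv k n).toEquiv.symm

instance fintypeDegreeLT [Finite k] (n : ℕ) : Fintype (Polynomial.degreeLT k n) :=
  Fintype.ofFinite _

theorem card_degreeLT [Finite k] (n : ℕ) : Nat.card (Polynomial.degreeLT k n) = Nat.card k ^ n := by
  rw [Nat.card_congr (Polynomial.degreeLTEquiv k n).toEquiv, Nat.card_fun, Nat.card_fin]

theorem mem_degreeLT_iff_coeff {n : ℕ} {p : k[X]} :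
    p ∈ Polynomial.degreeLT k n ↔ ∀ l, n ≤ l → p.coeff l = 0 := by
  rw [Polynomial.mem_degreeLT, Polynomial.degree_lt_iff_coeff_zero]

theorem scaledPart_add (l : ℕ) (f g : k⟦X⟧) :
    scaledPart l (f + g) = scaledPart l f + scaledPart l g := by
  ext n
  simp only [Polynomial.coeff_add, coeff_scaledPart]
  split_ifs <;> simp

theorem scaledPart_mem_degreeLT (l : ℕ) (f : k⟦X⟧) :
    scaledPart l f ∈ Polynomial.degreeLT k (l + 1) :=
  mem_degreeLT_iff_coeff.mpr fun n hn => by rw [coeff_scaledPart, if_neg (by omega)]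

theorem scaledPart_X_mul_mem_degreeLT (l : ℕ) (f : k⟦X⟧) :
    scaledPart l (PowerSeries.X * f) ∈ Polynomial.degreeLT k l :=
  mem_degreeLT_iff_coeff.mpr fun n hn => by
    rw [coeff_scaledPart]
    split_ifs with h
    · rw [show l - n = 0 by omega]
      simp
    · rfl

theorem scaledPart_X_pow {l m : ℕ} (h : m ≤ l) :
    scaledPart l (PowerSeries.X ^ m : k⟦X⟧) = Polynomial.X ^ (l - m) := by
  ext n
  rw [coeff_scaledPart, Polynomial.coeff_X_pow, PowerSeries.coeff_X_pow]
  split_ifs <;> first | rfl | omega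

theorem scaledPart_one (l : ℕ) : scaledPart l (1 : k⟦X⟧) = Polynomial.X ^ l := by
  simpa using scaledPart_X_pow (k := k) (Nat.zero_le l)

theorem scaledPart_neg (l : ℕ) (f : k⟦X⟧) : scaledPart l (-f) = -scaledPart l f := by
  ext n
  simp only [Polynomial.coeff_neg, coeff_scaledPart]
  split_ifs <;> simp

theorem mul_rep_congr {n : ℕ} (g : k⟦X⟧) {a : ResidueRing k n} {f : k⟦X⟧}
    (h : Ideal.Quotient.mk _ f = a) :
    (Ideal.Quotient.mk _ (g * rep a) : ResidueRing k n) = Ideal.Quotient.mk _ (g * f) := by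
  rw [map_mul, map_mul, mk_rep, h]

/-- The map `a ↦ [π⁻ˡ g a]` on `𝒪 / πⁿ 𝒪`, which is well defined and additive for `l < n`. -/
def scaledHom (g : k⟦X⟧) {l n : ℕ} (h : l < n) : ResidueRing k n →+ k[X] :=
  AddMonoidHom.mk' (fun a => scaledPart l (g * rep a)) fun a b => by
    rw [← scaledPart_add, ← mul_add]
    exact scaledPart_congr h (mul_rep_congr g (by rw [map_add, mk_rep, mk_rep]))

theorem scaledHom_apply (g : k⟦X⟧) {l n : ℕ} (h : l < n) (a : ResidueRing k n) :
    scaledHom g h a = scaledPart l (g * rep a) := rfl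

theorem scaledHom_mk (g : k⟦X⟧) {l n : ℕ} (h : l < n) (f : k⟦X⟧) :
    scaledHom g h (Ideal.Quotient.mk _ f) = scaledPart l (g * f) :=
  scaledPart_congr h (mul_rep_congr g rfl)

theorem scaledHom_one_sq {l n : ℕ} (h : l < n) (a : ResidueRing k n) :
    scaledHom 1 h (a ^ 2) = scaledPart l (rep a ^ 2) := by
  have e : a ^ 2 = Ideal.Quotient.mk _ (rep a ^ 2) := by rw [map_pow, mk_rep]
  rw [e, scaledHom_mk, one_mul]

theorem exists_scaledHom_one_eq {l n : ℕ} (h : l < n) {p : k[X]}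
    (hp : p ∈ Polynomial.degreeLT k (l + 1)) : ∃ a, scaledHom 1 h a = p := by
  refine ⟨Ideal.Quotient.mk _ (PowerSeries.mk fun t => p.coeff (l - t)), ?_⟩
  rw [scaledHom_mk, one_mul]
  ext d
  rw [coeff_scaledPart]
  split_ifs with hd
  · rw [PowerSeries.coeff_mk]
    congr 1
    omega
  · exact (mem_degreeLT_iff_coeff.mp hp d (by omega)).symm

theorem exists_scaledHom_X_eq {l n : ℕ} (h : l < n) {p : k[X]}
    (hp : p ∈ Polynomial.degreeLT k l) : ∃ a, scaledHom PowerSeries.X h a = p := by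
  refine ⟨Ideal.Quotient.mk _ (PowerSeries.mk fun t => p.coeff (l - 1 - t)), ?_⟩
  rw [scaledHom_mk]
  ext d
  rw [coeff_scaledPart]
  rcases lt_or_ge d l with hd | hd
  · rw [if_pos hd.le, show l - d = l - d - 1 + 1 by omega, PowerSeries.coeff_succ_X_mul,
      PowerSeries.coeff_mk]
    congr 1
    omega
  · rw [mem_degreeLT_iff_coeff.mp hp d hd]
    split_ifs
    · rw [show l - d = 0 by omega]
      simp
    · rfl

theorem scaledHom_one_injective (i : ℕ) :
    Function.Injective (scaledHom (1 : k⟦X⟧) (Nat.lt_succ_self i)) := by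
  rw [injective_iff_map_eq_zero]
  intro a ha
  rw [← mk_rep a]
  refine Ideal.Quotient.eq_zero_iff_mem.mpr
    (Ideal.mem_span_singleton.mpr (PowerSeries.X_pow_dvd_iff.mpr fun t ht => ?_))
  have h := congrArg (fun p => p.coeff (i - t)) ha
  simp only [scaledHom_apply, one_mul, coeff_scaledPart, Polynomial.coeff_zero] at h
  rw [if_pos (by omega)] at h
  rwa [show i - (i - t) = t by omega] at h

theorem card_residueRing [Finite k] (i : ℕ) :
    Fintype.card (ResidueRing k (i + 1)) = Nat.card k ^ (i + 1) := by
  rw [← Nat.card_eq_fintype_card, ← card_degreeLT]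
  refine Nat.card_congr (Equiv.ofBijective
    (fun a => ⟨scaledHom 1 (Nat.lt_succ_self i) a, scaledPart_mem_degreeLT _ _⟩) ⟨?_, ?_⟩)
  · intro a b h
    exact scaledHom_one_injective i (congrArg Subtype.val h)
  · rintro ⟨p, hp⟩
    obtain ⟨a, ha⟩ := exists_scaledHom_one_eq (Nat.lt_succ_self i) hp
    exact ⟨a, Subtype.ext ha⟩

/-- A power series with a nonzero coefficient of index `t` divides `Xᴺ` for every `N ≥ t`. -/
theorem dvd_X_pow_of_coeff_ne_zero {f : k⟦X⟧} {t N : ℕ} (h : PowerSeries.coeff t f ≠ 0)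
    (hN : t ≤ N) : f ∣ PowerSeries.X ^ N := by
  have hf : f ≠ 0 := by
    rintro rfl
    simp at h
  obtain ⟨u, hu⟩ := PowerSeries.isUnit_divided_by_X_pow_order hf
  have hord : f.order.toNat ≤ N :=
    (ENat.toNat_le_of_le_natCast (PowerSeries.order_le t h)).trans hN
  rw [← PowerSeries.X_pow_order_mul_divXPowOrder (f := f), ← hu]
  exact (Units.mul_right_dvd).mpr (pow_dvd_pow _ hord)

end Truncation

/-! ### The abelian group -/

section Abelian

variable {k : Type*} [Field k]

theorem h₁_mul (x y z x' y' z' : k[X]) :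
    h₁ x y z * h₁ x' y' z' = h₁ (x + x') (y + y') (z + z') :=
  Subtype.ext (sl₁_mul x y z x' y' z')

theorem h₁_inv (x y z : k[X]) : (h₁ x y z)⁻¹ = h₁ (-x) (-y) (-z) := by
  refine inv_eq_of_mul_eq_one_right ?_
  rw [h₁_mul]
  refine Subtype.ext ?_
  simpa [h₁] using sl₁_zero (k := k)

variable {W : Type*} [CStarAlgebra W] (ρ : H₁ k →* unitary W)

/-- The operator of `h₁(x, y, z)` in a unitary representation. -/
def op₁ (x y z : k[X]) : W := ρ (h₁ x y z)

theorem op₁_mul (x y z x' y' z' : k[X]) :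
    op₁ ρ x y z * op₁ ρ x' y' z' = op₁ ρ (x + x') (y + y') (z + z') := by
  rw [op₁, op₁, ← Submonoid.coe_mul, ← map_mul, h₁_mul, op₁]

theorem star_op₁ (x y z : k[X]) : star (op₁ ρ x y z) = op₁ ρ (-x) (-y) (-z) := by
  rw [op₁, op₁, ← h₁_inv, map_inv]
  rfl

theorem norm_op₁_le (x y z : k[X]) : ‖op₁ ρ x y z‖ ≤ 1 := norm_unitary_le _

variable [Finite k]

/-- If `d` has valuation less than `i - j`, then `a ↦ [2π⁻ⁱ a d]` takes the value
`π⁻⁽ʲ⁺¹⁾ - π⁻ʲ`, and the mean over its values does not see the difference of these two powers. -/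
theorem average_op₁_mul_sub_eq_zero (h2 : (2 : k) ≠ 0) {i j : ℕ} (hij : j < i)
    (d : ResidueRing k (i + 1))
    (hd : scaledHom 1 (Nat.lt_succ_self i) d ∉ Polynomial.degreeLT k (j + 1)) :
    (average fun a => op₁ ρ 0 0 (scaledHom 1 (Nat.lt_succ_self i) (2 * a * d))) *
      (op₁ ρ 0 0 (Polynomial.X ^ j) - op₁ ρ 0 0 (Polynomial.X ^ (j + 1))) = 0 := by
  obtain ⟨a₀, ha₀⟩ : ∃ a₀, scaledHom 1 (Nat.lt_succ_self i) (2 * a₀ * d) =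
      Polynomial.X ^ (j + 1) - (Polynomial.X ^ j : k[X]) := by
    simp only [mem_degreeLT_iff_coeff, not_forall] at hd
    obtain ⟨n, hn, hcoeff⟩ := hd
    rw [scaledHom_apply, one_mul, coeff_scaledPart] at hcoeff
    split_ifs at hcoeff with hni
    · obtain ⟨g, hg⟩ := dvd_X_pow_of_coeff_ne_zero hcoeff (show i - n ≤ i - j - 1 by omega)
      refine ⟨Ideal.Quotient.mk _ (PowerSeries.C (2⁻¹ : k) * g * (1 - PowerSeries.X)), ?_⟩
      have e : (2 * Ideal.Quotient.mk _ (PowerSeries.C (2⁻¹ : k) * g * (1 - PowerSeries.X)) * d :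
          ResidueRing k (i + 1)) = Ideal.Quotient.mk _
            (PowerSeries.X ^ (i - j - 1) + -PowerSeries.X ^ (i - j)) := by
        conv_lhs => rw [← mk_rep d, ← map_ofNat (Ideal.Quotient.mk _) 2, ← map_mul, ← map_mul]
        congr 1
        have hC : (2 : k⟦X⟧) * PowerSeries.C (2⁻¹ : k) = 1 := by
          rw [← map_ofNat (PowerSeries.C (R := k)) 2, ← map_mul, mul_inv_cancel₀ h2, map_one]
        rw [show i - j = i - j - 1 + 1 by omega, pow_succ, Nat.add_sub_cancel, hg]
        linear_combination (rep d * g * (1 - PowerSeries.X)) * hC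
      rw [e, scaledHom_mk, one_mul, scaledPart_add, scaledPart_neg, scaledPart_X_pow (by omega),
        scaledPart_X_pow (by omega), ← sub_eq_add_neg]
      congr 2 <;> omega
    · exact absurd rfl hcoeff
  rw [mul_sub, average_mul, average_mul, sub_eq_zero]
  rw [← average_comp_add _ a₀]
  congr 1
  funext a
  rw [op₁_mul, op₁_mul, mul_add, add_mul, map_add, ha₀]
  congr 1
  ring

/-- The Gauss sum estimate, by expanding the square of the operator. -/
theorem norm_average_op₁_mul_sub_le (h2 : (2 : k) ≠ 0) {i j : ℕ} (hij : j ≤ i) :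
    ‖average fun a : ResidueRing k (i + 1) =>
        op₁ ρ (scaledHom 1 (Nat.lt_succ_self i) a) (Polynomial.X ^ i)
          (scaledHom 1 (Nat.lt_succ_self i) (a ^ 2)) *
        (op₁ ρ 0 0 (Polynomial.X ^ j) - op₁ ρ 0 0 (Polynomial.X ^ (j + 1)))‖ ≤
      2 * (Nat.card k : ℝ) ^ (-(((i : ℝ) - (j : ℝ)) / 2)) := by
  have hq : (0 : ℝ) < Nat.card k := by exact_mod_cast Nat.card_pos
  set s := scaledHom (1 : k⟦X⟧) (Nat.lt_succ_self i)
  set D := op₁ ρ 0 0 (Polynomial.X ^ j) - op₁ ρ 0 0 (Polynomial.X ^ (j + 1) : k[X]) with hD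
  have hD2 : ‖D‖ ≤ 2 := norm_unitary_sub_le _ _
  rcases hij.eq_or_lt with rfl | hij
  · rw [sub_self, zero_div, neg_zero, Real.rpow_zero, mul_one]
    refine norm_average_le _ zero_le_two fun a => ?_
    refine (norm_mul_le _ _).trans ?_
    nlinarith [norm_op₁_le ρ (s a) (Polynomial.X ^ j) (s (a ^ 2)), norm_nonneg D]
  set A := average fun a => op₁ ρ (s a) (Polynomial.X ^ i) (s (a ^ 2)) * D with hA
  -- Expanding the square and substituting `b = d + a` isolates the mean over `a` of the
  -- characters `2ad`, for each fixed difference `d`.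
  have hAA : star A * A = star D * average fun d : ResidueRing k (i + 1) =>
      op₁ ρ (s d) 0 (s (d ^ 2)) * ((average fun a => op₁ ρ 0 0 (s (2 * a * d))) * D) := by
    simp only [hA, star_average, average_mul, mul_average]
    conv_rhs => rw [average_comm]
    rw [average_comm]
    congr 1
    funext a
    rw [← average_comp_add _ a]
    congr 1
    funext d
    rw [star_mul, star_op₁, mul_assoc, ← mul_assoc (op₁ ρ _ _ _) (op₁ ρ _ _ _) D,
      ← mul_assoc (op₁ ρ _ _ _) (op₁ ρ _ _ _) D, op₁_mul, op₁_mul]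
    have e : (d + a) ^ 2 = d ^ 2 + 2 * a * d + a ^ 2 := by ring
    rw [e, map_add, map_add, map_add]
    congr 3 <;> ring
  have hnorm : ‖A‖ * ‖A‖ ≤
      2 * (((Nat.card k : ℝ) ^ (i + 1))⁻¹ * ((Nat.card k : ℝ) ^ (j + 1) * 2)) := by
    rw [← CStarRing.norm_star_mul_self, hAA]
    refine (norm_mul_le _ _).trans ?_
    rw [norm_star]
    refine mul_le_mul hD2 ?_ (norm_nonneg _) zero_le_two
    have := norm_average_le_of_card_le (fun d : ResidueRing k (i + 1) =>
      op₁ ρ (s d) 0 (s (d ^ 2)) * ((average fun a => op₁ ρ 0 0 (s (2 * a * d))) * D)) zero_le_two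
      (fun d => ?_) (fun d => s d ∈ Polynomial.degreeLT k (j + 1)) (fun d hd => ?_)
      (n := Nat.card k ^ (j + 1)) ?_
    · rw [card_residueRing] at this
      exact_mod_cast this
    · have h₁ := norm_average_le (fun a : ResidueRing k (i + 1) => op₁ ρ 0 0 (s (2 * a * d)))
        zero_le_one fun a => norm_op₁_le ρ _ _ _
      calc _ ≤ ‖op₁ ρ (s d) 0 (s (d ^ 2))‖ *
            (‖average fun a => op₁ ρ 0 0 (s (2 * a * d))‖ * ‖D‖) :=
            (norm_mul_le _ _).trans (by gcongr; exact norm_mul_le _ _)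
        _ ≤ 1 * (1 * 2) := by
            gcongr
            exact norm_op₁_le ρ _ _ _
        _ = 2 := by norm_num
    · rw [average_op₁_mul_sub_eq_zero ρ h2 hij d hd, mul_zero]
    · rw [← card_degreeLT]
      exact Nat.card_le_card_of_injective (fun d => ⟨s d.1, d.2⟩) fun d d' h =>
        Subtype.ext (scaledHom_one_injective i (congrArg Subtype.val h))
  refine abs_le_of_sq_le_sq' ?_ (by positivity) |>.2
  rw [sq, sq]
  refine hnorm.trans_eq ?_
  rw [mul_mul_mul_comm, ← Real.rpow_add hq, ← Real.rpow_natCast, ← Real.rpow_natCast,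
    ← Real.rpow_neg hq.le,
    show -(((i : ℝ) - j) / 2) + -(((i : ℝ) - j) / 2) = -((i + 1 : ℕ) : ℝ) + ((j + 1 : ℕ) : ℝ) by
      push_cast; ring, Real.rpow_add hq]
  ring

theorem lift_Δ₁ (i j : ℕ) :
    MonoidAlgebra.lift ℂ W (H₁ k) ((unitary W).subtype.comp ρ) (Δ₁ k i j) =
      average fun a : ResidueRing k (i + 1) =>
        op₁ ρ (scaledHom 1 (Nat.lt_succ_self i) a) (Polynomial.X ^ i)
          (scaledHom 1 (Nat.lt_succ_self i) (a ^ 2)) *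
        (op₁ ρ 0 0 (Polynomial.X ^ j) - op₁ ρ 0 0 (Polynomial.X ^ (j + 1))) := by
  have key : ∀ n, MonoidAlgebra.lift ℂ W (H₁ k) ((unitary W).subtype.comp ρ) (mean₁ k i n) =
      average fun a : ResidueRing k (i + 1) =>
        op₁ ρ (scaledHom 1 (Nat.lt_succ_self i) a) (Polynomial.X ^ i)
          (scaledHom 1 (Nat.lt_succ_self i) (a ^ 2)) * op₁ ρ 0 0 (Polynomial.X ^ n) := by
    intro n
    rw [mean₁, lift_average_single]
    refine congrArg average (funext fun a => ?_)
    rw [op₁_mul, scaledHom_one_sq, scaledHom_apply, one_mul, add_zero, add_zero, op₁]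
  rw [Δ₁, map_sub, key, key, ← average_mul, ← average_mul, ← average_mul, mul_sub]

theorem reducedNorm_Δ₁_le (h2 : (2 : k) ≠ 0) {i j : ℕ} (hij : j ≤ i) :
    reducedNorm (Δ₁ k i j) ≤ 2 * (Nat.card k : ℝ) ^ (-(((i : ℝ) - (j : ℝ)) / 2)) := by
  rw [reducedNorm_eq, lift_Δ₁]
  exact norm_average_op₁_mul_sub_le _ h2 hij

end Abelian

/-! ### The Heisenberg group -/

section Heisenberg

variable {k : Type*} [Field k]

theorem h₂_mul (x y z x' y' z' : k[X]) :
    h₂ x y z * h₂ x' y' z' = h₂ (x + x') (y + y')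
      (z + z' + Polynomial.C (2⁻¹ : k) * (x * y' - y * x')) :=
  Subtype.ext (sl₂_mul x y z x' y' z')

theorem h₂_inv (x y z : k[X]) : (h₂ x y z)⁻¹ = h₂ (-x) (-y) (-z) := by
  refine inv_eq_of_mul_eq_one_right ?_
  rw [h₂_mul, show x * -y - y * -x = 0 by ring]
  refine Subtype.ext ?_
  simpa [h₂] using sl₂_zero (k := k)

variable {W : Type*} [CStarAlgebra W] (ρ : H₂ k →* unitary W)

/-- The operator of `h₂(x, y, z)` in a unitary representation. -/
def op₂ (x y z : k[X]) : W := ρ (h₂ x y z)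

theorem op₂_mul (x y z x' y' z' : k[X]) :
    op₂ ρ x y z * op₂ ρ x' y' z' = op₂ ρ (x + x') (y + y')
      (z + z' + Polynomial.C (2⁻¹ : k) * (x * y' - y * x')) := by
  rw [op₂, op₂, ← Submonoid.coe_mul, ← map_mul, h₂_mul, op₂]

theorem star_op₂ (x y z : k[X]) : star (op₂ ρ x y z) = op₂ ρ (-x) (-y) (-z) := by
  rw [op₂, op₂, ← h₂_inv, map_inv]
  rfl

theorem norm_op₂_le (x y z : k[X]) : ‖op₂ ρ x y z‖ ≤ 1 := norm_unitary_le _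

theorem op₂_central_mul (w x y z : k[X]) : op₂ ρ 0 0 w * op₂ ρ x y z = op₂ ρ x y (w + z) := by
  rw [op₂_mul]
  congr 1 <;> ring

theorem op₂_mul_central (x y z w : k[X]) : op₂ ρ x y z * op₂ ρ 0 0 w = op₂ ρ x y (z + w) := by
  rw [op₂_mul]
  congr 1 <;> ring

theorem commute_star_of_commute {ρ : H₂ k →* unitary W} {D : W}
    (hD : ∀ x y z, Commute D (op₂ ρ x y z)) (x y z : k[X]) : Commute (star D) (op₂ ρ x y z) := by
  have := (hD (-x) (-y) (-z)).star_star
  rwa [star_op₂, neg_neg, neg_neg, neg_neg] at this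

variable [Finite k]

/-- The mean over `y` of degree at most `m` of the operators of `h₂(0, y, -xy/2)`. These elements
form a subgroup, so this is the projection to its invariant vectors. -/
def fibreProj (m : ℕ) (x : k[X]) : W :=
  average fun y : Polynomial.degreeLT k (m + 1) =>
    op₂ ρ 0 (y : k[X]) (-(Polynomial.C (2⁻¹ : k) * (x * y)))

/-- The mean over the monic polynomials `z` of degree `n` of the central operators `h₂(0, 0, z)`. -/
def monicMean (n : ℕ) : W :=
  average fun z : Polynomial.degreeLT k n => op₂ ρ 0 0 (Polynomial.X ^ n + (z : k[X]))

theorem norm_fibreProj_le (m : ℕ) (x : k[X]) : ‖fibreProj ρ m x‖ ≤ 1 :=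
  norm_average_le _ zero_le_one fun _ => norm_op₂_le _ _ _ _

theorem norm_monicMean_sub_le (i n : ℕ) : ‖monicMean ρ i - monicMean ρ n‖ ≤ 2 := by
  have h : ∀ i, ‖monicMean ρ i‖ ≤ 1 := fun i =>
    norm_average_le _ zero_le_one fun _ => norm_op₂_le _ _ _ _
  linarith [norm_sub_le (monicMean ρ i) (monicMean ρ n), h i, h n]

theorem star_fibreProj (m : ℕ) (x : k[X]) : star (fibreProj ρ m x) = fibreProj ρ m x := by
  rw [fibreProj, star_average, ← average_equiv (Equiv.neg _)]
  congr 1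
  funext y
  rw [star_op₂]
  simp

theorem fibreProj_mul_op₂ (m : ℕ) (x : k[X]) (y : Polynomial.degreeLT k (m + 1)) :
    fibreProj ρ m x * op₂ ρ 0 (y : k[X]) (-(Polynomial.C (2⁻¹ : k) * (x * y))) =
      fibreProj ρ m x := by
  rw [fibreProj, average_mul]
  conv_rhs => rw [← average_comp_add _ y]
  congr 1
  funext y'
  rw [op₂_mul, Submodule.coe_add]
  congr 1 <;> ring

/-- Products of two projections bring in the mean over the central subgroup of multiples of the
difference of their parameters. -/
theorem fibreProj_mul_fibreProj (m : ℕ) (x x' : k[X]) :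
    fibreProj ρ m x * fibreProj ρ m x' = fibreProj ρ m x *
      average fun y : Polynomial.degreeLT k (m + 1) =>
        op₂ ρ 0 0 (Polynomial.C (2⁻¹ : k) * (x - x') * y) := by
  conv_lhs => rw [fibreProj.eq_1 ρ m x']
  rw [mul_average, mul_average]
  congr 1
  funext y
  conv_rhs => rw [← fibreProj_mul_op₂ ρ m x y, mul_assoc, op₂_mul_central]
  congr 2
  ring

/-- Conjugation by `h₂(e, 0, 0)` shifts the parameter of the projections by `2e`. -/
theorem op₂_mul_fibreProj (h2 : (2 : k) ≠ 0) (m : ℕ) (e x : k[X]) :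
    op₂ ρ e 0 0 * fibreProj ρ m x = fibreProj ρ m (x - 2 * e) * op₂ ρ e 0 0 := by
  rw [fibreProj, fibreProj, mul_average, average_mul]
  congr 1
  funext y
  have hC : (2 : k[X]) * Polynomial.C (2⁻¹ : k) = 1 := by
    rw [← map_ofNat (Polynomial.C (R := k)) 2, ← map_mul, mul_inv_cancel₀ h2, map_one]
  rw [op₂_mul, op₂_mul]
  congr 1
  · ring
  · ring
  · linear_combination (-e * (y : k[X])) * hC + (e * (y : k[X])) * hC

theorem commute_monicMean_op₂ (n : ℕ) (x y z : k[X]) :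
    Commute (monicMean ρ n) (op₂ ρ x y z) := by
  rw [Commute, SemiconjBy, monicMean, average_mul, mul_average]
  congr 1
  funext w
  rw [op₂_central_mul, op₂_mul_central, add_comm]

theorem commute_fibreProj {ρ : H₂ k →* unitary W} {D : W}
    (hD : ∀ x y z, Commute D (op₂ ρ x y z)) (m : ℕ) (x : k[X]) :
    Commute D (fibreProj ρ m x) := by
  rw [Commute, SemiconjBy, fibreProj, average_mul, mul_average]
  congr 1
  funext y
  exact hD _ _ _

/-- The central operators of the multiples `d y` and of the polynomials of degree less than `i`
together contain those of all polynomials of degree at most `i + 1` (by division with remainder),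
so the two monic means have the same product with the mean over the multiples of `d`. -/
theorem average_mul_monicMean_sub_eq_zero {i m : ℕ} {d : k[X]} (hd : d ≠ 0)
    (hdi : d.natDegree ≤ i) (hdm : i + 1 ≤ m + d.natDegree) :
    (average fun y : Polynomial.degreeLT k (m + 1) => op₂ ρ 0 0 (d * y)) *
      (monicMean ρ i - monicMean ρ (i + 1)) = 0 := by
  set M := average fun y : Polynomial.degreeLT k (m + 1) => op₂ ρ 0 0 (d * y) with hM
  set P := average fun z : Polynomial.degreeLT k i => op₂ ρ 0 0 (z : k[X]) with hP
  have hM' : ∀ y ∈ Polynomial.degreeLT k (m + 1), M * op₂ ρ 0 0 (d * y) = M := by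
    intro y hy
    rw [hM, average_mul]
    conv_rhs => rw [← average_comp_add _ ⟨y, hy⟩]
    congr 1
    funext y'
    rw [op₂_mul_central, Submodule.coe_add, mul_add]
  have hP' : ∀ z ∈ Polynomial.degreeLT k i, P * op₂ ρ 0 0 z = P := by
    intro z hz
    rw [hP, average_mul]
    conv_rhs => rw [← average_comp_add _ ⟨z, hz⟩]
    congr 1
    funext z'
    rw [op₂_mul_central, Submodule.coe_add]
  have hcomm : ∀ w, P * op₂ ρ 0 0 w = op₂ ρ 0 0 w * P := by
    intro w
    rw [hP, average_mul, mul_average]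
    congr 1
    funext z
    rw [op₂_mul_central, op₂_mul_central, add_comm]
  have hMP : ∀ w ∈ Polynomial.degreeLT k (i + 2), M * P * op₂ ρ 0 0 w = M * P := by
    intro w hw
    have hmod : w % d ∈ Polynomial.degreeLT k i :=
      Polynomial.mem_degreeLT.mpr ((EuclideanDomain.mod_lt w hd).trans_le
        (Polynomial.degree_le_of_natDegree_le hdi))
    have hdiv : w / d ∈ Polynomial.degreeLT k (m + 1) := by
      have hw' : w.natDegree ≤ i + 1 := by
        rw [Polynomial.natDegree_le_iff_coeff_eq_zero]
        exact fun l hl => mem_degreeLT_iff_coeff.mp hw l hl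
      rw [mem_degreeLT_iff_coeff]
      intro l hl
      refine Polynomial.coeff_eq_zero_of_natDegree_lt ?_
      rcases lt_or_ge w.degree d.degree with hlt | hge
      · rw [(Polynomial.div_eq_zero_iff hd).mpr hlt, Polynomial.natDegree_zero]
        omega
      · rcases eq_or_ne (w / d) 0 with h0 | h0
        · rw [h0, Polynomial.natDegree_zero]
          omega
        · have hmul := Polynomial.degree_add_div hd hge
          rw [← Polynomial.degree_mul] at hmul
          have hnat := Polynomial.natDegree_eq_of_degree_eq hmul
          rw [Polynomial.natDegree_mul hd h0] at hnat
          omega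
    rw [← EuclideanDomain.div_add_mod w d, ← op₂_mul_central, mul_assoc, ← mul_assoc P, hcomm,
      mul_assoc, hP' _ hmod, ← mul_assoc, hM' _ hdiv]
  have key : ∀ n, i ≤ n → n ≤ i + 1 → M * monicMean ρ n = M * P := by
    intro n hin hni
    have hPn : P * monicMean ρ n = monicMean ρ n := by
      rw [hP, average_mul, ← average_const (ι := Polynomial.degreeLT k i) (monicMean ρ n)]
      congr 1
      funext z
      rw [average_const, monicMean, mul_average]
      conv_rhs => rw [← average_comp_add _ ⟨z, Polynomial.degreeLT_mono hin z.2⟩]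
      congr 1
      funext z'
      rw [op₂_mul_central, Submodule.coe_add]
      congr 1
      ring
    rw [← hPn, ← mul_assoc, monicMean, mul_average]
    rw [← average_const (ι := Polynomial.degreeLT k n) (M * P)]
    congr 1
    funext z
    rw [average_const]
    refine hMP _ (add_mem ?_ (Polynomial.degreeLT_mono (by omega) z.2))
    rw [mem_degreeLT_iff_coeff]
    intro l hl
    rw [Polynomial.coeff_X_pow, if_neg (by omega)]
  rw [mul_sub, key i le_rfl (by omega), key (i + 1) (by omega) le_rfl, sub_self]

theorem fibreProj_mul_fibreProj_mul_eq_zero (h2 : (2 : k) ≠ 0) {i m n : ℕ} {x x' : k[X]}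
    (hmi : m ≤ i) (hx : x - x' ∈ Polynomial.degreeLT k m) (hn : i + 1 ≤ m + n)
    (hcoeff : (x - x').coeff n ≠ 0) :
    fibreProj ρ m x * fibreProj ρ m x' * (monicMean ρ i - monicMean ρ (i + 1)) = 0 := by
  have hC : (2⁻¹ : k) ≠ 0 := inv_ne_zero h2
  have hdeg : (Polynomial.C (2⁻¹ : k) * (x - x')).natDegree = (x - x').natDegree :=
    Polynomial.natDegree_C_mul hC
  have hne : x - x' ≠ 0 := by
    intro h
    rw [h] at hcoeff
    exact hcoeff rfl
  have hle : n ≤ (x - x').natDegree := Polynomial.le_natDegree_of_ne_zero hcoeff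
  have hlt : (x - x').natDegree < m := by
    by_contra h
    exact hne (Polynomial.leadingCoeff_eq_zero.mp (mem_degreeLT_iff_coeff.mp hx _ (by omega)))
  rw [fibreProj_mul_fibreProj, mul_assoc, average_mul_monicMean_sub_eq_zero, mul_zero]
  · exact mul_ne_zero (Polynomial.C_ne_zero.mpr hC) hne
  · omega
  · omega

/-- The operators `h₂(x, 0, 0) Q_x D`, over monic `x` of degree `m`, are orthogonal on both sides
as soon as the parameters differ in a coefficient of index at least `i + 1 - m`. -/
theorem norm_average_op₂_mul_le (h2 : (2 : k) ≠ 0) {i j m : ℕ} (hm : (i + j) / 2 = m)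
    (hji : j ≤ i) :
    ‖average fun x : Polynomial.degreeLT k m =>
      op₂ ρ (Polynomial.X ^ m + (x : k[X])) 0 0 *
        (fibreProj ρ m (Polynomial.X ^ m + (x : k[X])) *
          (monicMean ρ i - monicMean ρ (i + 1)))‖ ≤
      2 * (Nat.card k : ℝ) ^ 2 * (Nat.card k : ℝ) ^ (-(j : ℤ)) := by
  set D := monicMean ρ i - monicMean ρ (i + 1) with hD
  have hDop : ∀ x y z, Commute D (op₂ ρ x y z) := fun x y z =>
    (commute_monicMean_op₂ ρ i x y z).sub_left (commute_monicMean_op₂ ρ (i + 1) x y z)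
  have hvanish : ∀ (a b : k[X]) (x y : Polynomial.degreeLT k m), a - b = (x : k[X]) - y →
      (fun n => (x : k[X]).coeff (i + 1 - m + n)) ≠ (fun n => (y : k[X]).coeff (i + 1 - m + n)) →
      fibreProj ρ m a * fibreProj ρ m b * D = 0 := by
    intro a b x y hab hxy
    obtain ⟨n, hn⟩ := Function.ne_iff.mp hxy
    refine fibreProj_mul_fibreProj_mul_eq_zero ρ h2 (n := i + 1 - m + n) (by omega) ?_ (by omega) ?_
    · rw [hab]
      exact sub_mem x.2 y.2
    · rw [hab, Polynomial.coeff_sub]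
      exact sub_ne_zero.mpr hn
  have hbound := norm_average_le_of_orthogonal_classes
    (fun x : Polynomial.degreeLT k m => op₂ ρ (Polynomial.X ^ m + (x : k[X])) 0 0 *
        (fibreProj ρ m (Polynomial.X ^ m + (x : k[X])) * D))
    (fun x n => (x : k[X]).coeff (i + 1 - m + n)) zero_le_two (fun x => ?_) (fun x y hxy => ?_)
    (fun x y hxy => ?_) (n := Nat.card k ^ (i + 1 - m)) (fun c => ?_)
  · refine hbound.trans ?_
    have hq : (1 : ℝ) ≤ Nat.card k := by exact_mod_cast Nat.card_pos
    have hq0 : (0 : ℝ) < Nat.card k := by linarith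
    rw [← Nat.card_eq_fintype_card, card_degreeLT, zpow_neg, zpow_natCast, Nat.cast_pow,
      Nat.cast_pow, inv_mul_le_iff₀ (by positivity), ← mul_assoc, ← div_eq_mul_inv,
      le_div_iff₀ (by positivity)]
    calc (Nat.card k : ℝ) ^ (i + 1 - m) * 2 * (Nat.card k : ℝ) ^ j
        = 2 * (Nat.card k : ℝ) ^ (i + 1 - m + j) := by ring
      _ ≤ 2 * (Nat.card k : ℝ) ^ (m + 2) := by
          exact mul_le_mul_of_nonneg_left (pow_le_pow_right₀ hq (by omega)) zero_le_two
      _ = _ := by ring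
  · calc _ ≤ ‖op₂ ρ (Polynomial.X ^ m + (x : k[X])) 0 0‖ *
          (‖fibreProj ρ m (Polynomial.X ^ m + (x : k[X]))‖ * ‖D‖) :=
          (norm_mul_le _ _).trans (by gcongr; exact norm_mul_le _ _)
      _ ≤ 1 * (1 * 2) := by
          gcongr
          · exact norm_op₂_le _ _ _ _
          · exact norm_fibreProj_le _ _ _
          · exact norm_monicMean_sub_le _ _ _
      _ = 2 := by norm_num
  · set a := Polynomial.X ^ m + (x : k[X])
    set b := Polynomial.X ^ m + (y : k[X])
    have h := hvanish a (b - 2 * (b - a)) y x (by ring) (Ne.symm hxy)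
    have e : star (op₂ ρ a 0 0) * op₂ ρ b 0 0 = op₂ ρ (b - a) 0 0 := by
      rw [star_op₂, op₂_mul]
      congr 1 <;> ring
    rw [star_mul, star_mul, star_fibreProj]
    calc _ = star D * (fibreProj ρ m a *
          (star (op₂ ρ a 0 0) * op₂ ρ b 0 0 * fibreProj ρ m b) * D) := by
          simp only [mul_assoc]
      _ = star D * (fibreProj ρ m a * fibreProj ρ m (b - 2 * (b - a)) *
          (op₂ ρ (b - a) 0 0 * D)) := by
          rw [e, op₂_mul_fibreProj ρ h2]
          simp only [mul_assoc]
      _ = 0 := by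
          rw [← (hDop _ _ _).eq, ← mul_assoc (fibreProj ρ m a * _), h, zero_mul, mul_zero]
  · set a := Polynomial.X ^ m + (x : k[X])
    set b := Polynomial.X ^ m + (y : k[X])
    have h := hvanish a b x y (by ring) hxy
    rw [star_mul, star_mul, star_fibreProj]
    calc _ = op₂ ρ a 0 0 * (fibreProj ρ m a * (D * (star D * fibreProj ρ m b)) *
          star (op₂ ρ b 0 0)) := by simp only [mul_assoc]
      _ = op₂ ρ a 0 0 * (fibreProj ρ m a * fibreProj ρ m b * D * star D *
          star (op₂ ρ b 0 0)) := by
          rw [(commute_fibreProj (commute_star_of_commute hDop) m b).eq, ← mul_assoc D,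
            (commute_fibreProj hDop m b).eq]
          simp only [mul_assoc]
      _ = 0 := by rw [h, zero_mul, zero_mul, mul_zero]
  · have hfun : Nat.card (Fin (i + 1 - m) → k) = Nat.card k ^ (i + 1 - m) := by
      rw [Nat.card_fun, Nat.card_fin]
    rw [← hfun]
    refine Nat.card_le_card_of_injective
      (fun x (t : Fin (i + 1 - m)) => (x.1 : k[X]).coeff t) fun x y hxy => ?_
    refine Subtype.ext (Subtype.ext (Polynomial.ext fun n => ?_))
    rcases lt_or_ge n (i + 1 - m) with hn | hn
    · exact congrFun hxy ⟨n, hn⟩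
    · have := congrFun (x.2.trans y.2.symm) (n - (i + 1 - m))
      simpa only [Nat.add_sub_cancel' hn] using this

/-- The truncations in the definition of `mean₂` are surjective homomorphisms, so the mean is over
the `x, z` monic of degrees `m, i` and the `y` of degree at most `m`; it factors along
`h₂(x, y, z) = h₂(x, 0, 0) h₂(0, y, -xy/2) h₂(0, 0, z)`. -/
theorem lift_mean₂ {i j m : ℕ} (hm : (i + j) / 2 = m) (hmi : m ≤ i) :
    MonoidAlgebra.lift ℂ W (H₂ k) ((unitary W).subtype.comp ρ) (mean₂ k i j) =
      average fun x : Polynomial.degreeLT k m =>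
        op₂ ρ (Polynomial.X ^ m + (x : k[X])) 0 0 *
          (fibreProj ρ m (Polynomial.X ^ m + (x : k[X])) * monicMean ρ i) := by
  subst hm
  set m := (i + j) / 2
  have hmi' : m < i + 1 := by omega
  let φ₁ : ResidueRing k (i + 1) →+ Polynomial.degreeLT k m :=
    (scaledHom PowerSeries.X hmi').codRestrict (Polynomial.degreeLT k m).toAddSubgroup
      fun a => scaledPart_X_mul_mem_degreeLT m (rep a)
  let φ₂ : ResidueRing k (i + 1) →+ Polynomial.degreeLT k (m + 1) :=
    (scaledHom 1 hmi').codRestrict (Polynomial.degreeLT k (m + 1)).toAddSubgroup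
      fun a => scaledPart_mem_degreeLT m (1 * rep a)
  let φ₃ : ResidueRing k (i + 1) →+ Polynomial.degreeLT k i :=
    (scaledHom PowerSeries.X (Nat.lt_succ_self i)).codRestrict
      (Polynomial.degreeLT k i).toAddSubgroup
      fun a => scaledPart_X_mul_mem_degreeLT i (rep a)
  have s₁ : Function.Surjective φ₁ := fun p =>
    (exists_scaledHom_X_eq hmi' p.2).imp fun a ha => Subtype.ext ha
  have s₂ : Function.Surjective φ₂ := fun p =>
    (exists_scaledHom_one_eq hmi' p.2).imp fun a ha => Subtype.ext ha
  have s₃ : Function.Surjective φ₃ := fun p =>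
    (exists_scaledHom_X_eq (Nat.lt_succ_self i) p.2).imp fun a ha => Subtype.ext ha
  have e := average_comp_surjective (φ₁.prodMap (φ₂.prodMap φ₃)) (s₁.prodMap (s₂.prodMap s₃))
    fun t => op₂ ρ (Polynomial.X ^ m + (t.1 : k[X])) (t.2.1 : k[X])
      (Polynomial.X ^ i + (t.2.2 : k[X]))
  rw [mean₂, lift_average_single]
  refine Eq.trans (congrArg average (funext fun t => ?_)) (e.trans ?_)
  · change op₂ ρ _ _ _ = op₂ ρ (Polynomial.X ^ m + scaledPart m (PowerSeries.X * rep t.1))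
      (scaledPart m (1 * rep t.2.1))
      (Polynomial.X ^ i + scaledPart i (PowerSeries.X * rep t.2.2))
    rw [scaledPart_add, scaledPart_add, scaledPart_one, scaledPart_one, one_mul]
  · rw [average_prod]
    refine congrArg average (funext fun x => ?_)
    rw [average_prod, fibreProj, average_mul, mul_average]
    refine congrArg average (funext fun y => ?_)
    rw [monicMean, mul_average, mul_average]
    refine congrArg average (funext fun z => ?_)
    rw [op₂_mul_central, op₂_mul]
    congr 1 <;> ring

theorem lift_Δ₂ {i j : ℕ} (hj : 1 ≤ j) (hji : j ≤ i) :
    MonoidAlgebra.lift ℂ W (H₂ k) ((unitary W).subtype.comp ρ) (Δ₂ k i j) =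
      average fun x : Polynomial.degreeLT k ((i + j) / 2) =>
        op₂ ρ (Polynomial.X ^ ((i + j) / 2) + (x : k[X])) 0 0 *
          (fibreProj ρ ((i + j) / 2) (Polynomial.X ^ ((i + j) / 2) + (x : k[X])) *
            (monicMean ρ i - monicMean ρ (i + 1))) := by
  have hm : (i + 1 + (j - 1)) / 2 = (i + j) / 2 := by
    congr 1
    omega
  rw [Δ₂, map_sub, lift_mean₂ ρ rfl (by omega), lift_mean₂ ρ hm (by omega)]
  simp only [mul_sub, average, Finset.sum_sub_distrib, smul_sub]

theorem reducedNorm_Δ₂_le (h2 : (2 : k) ≠ 0) {i j : ℕ} (hj : 1 ≤ j) (hji : j ≤ i) :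
    reducedNorm (Δ₂ k i j) ≤
      2 * (Nat.card k : ℝ) ^ 2 * (Nat.card k : ℝ) ^ (-(j : ℤ)) := by
  rw [reducedNorm_eq, lift_Δ₂ _ hj hji]
  exact norm_average_op₂_mul_le _ h2 rfl hji

end Heisenberg

end ExplicitDiff

end

theorem proposition4p2 (k : Type*) [Field k] [Finite k] (hk : ringChar k ≠ 2) :
    (∀ i j : ℕ, j ≤ i →
      ExplicitDiff.reducedNorm (ExplicitDiff.Δ₁ k i j) ≤
        2 * (Nat.card k : ℝ) ^ (-(((i : ℝ) - (j : ℝ)) / 2))) ∧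
    (∀ i j : ℕ, 1 ≤ j → j ≤ i →
      ExplicitDiff.reducedNorm (ExplicitDiff.Δ₂ k i j) ≤
        2 * (Nat.card k : ℝ) ^ 2 * (Nat.card k : ℝ) ^ (-(j : ℤ))) := by
  have h2 : (2 : k) ≠ 0 := Ring.two_ne_zero hk
  exact ⟨fun i j hij => ExplicitDiff.reducedNorm_Δ₁_le h2 hij,
    fun i j hj hji => ExplicitDiff.reducedNorm_Δ₂_le h2 hj hji⟩
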